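/- Let $\mu$ be a symmetric probability measure on $\mathbb{R}$, absolutely continuous with respect to the Lebesgue measure, with cumulative distribution function $F_\mu(x)=\mu((-\infty,x])$ and tail function $\overline{F}_\mu=1-F_\mu$. Assume that $\log\overline{F}_\mu$ is convex on $\mathbb{R}^+=[0,\infty)$. Let $J_\mu=F_\mu'\circ F_\mu^{-1}$ on $(0,1)$ be the isoperimetric function of $\mu$, with the convention $J_\mu(0)=J_\mu(1)=0$; at a point where $F_\mu$ is not differentiable, $F_\mu'$ stands for the larger of the two one-sided derivatives. For $n\in\mathbb{N}$ let $\mu^n$ be the $n$-fold product measure on $\mathbb{R}^n$, and for a Borel set $A\subset\mathbb{R}^n$ put $$(\mu^n)_s(\partial A)=\liminf_{h\to0^+}\frac{\mu^n(A_h\setminus A)}{h}\in[0,\infty],\qquad A_h=\{x\in\mathbb{R}^n:\ d(x,A)\le h\},$$ where $d$ is the Euclidean distance and $A_h=\emptyset$ if $A=\emptyset$. Then, for every $n$, every Borel set $A\subset\mathbb{R}^n$ satisfies $$(\mu^n)_s(\partial A)\ \ge\ \frac{n\kappa_2}{\kappa_1}\,J_\mu\!\left(\frac{\min(\mu^n(A),\,1-\mu^n(A))}{2n\kappa_2}\right),$$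 where $\kappa_1=2\sqrt6$ and $\kappa_2=2(1+2\sqrt6)$. (For $n=0$ the right-hand side is read as $0$.) -/

import Mathlib

open MeasureTheory Set Filter Topology

noncomputable section

/-- The isoperimetric function `J_μ = F_μ' ∘ F_μ⁻¹` of a probability measure `μ` on the line, where
`F_μ` is the cumulative distribution function and `F_μ⁻¹` the quantile function, with the usual
convention that `J_μ` vanishes outside `(0, 1)`. The derivative of `F_μ` is taken to be the larger
of the two one-sided derivatives; this is `F_μ'` wherever `F_μ` is differentiable. -/
def isoFunction (μ : Measure ℝ) (t : ℝ) : ℝ :=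
  open Classical in
  if t ∈ Ioo (0 : ℝ) 1 then
    let q : ℝ := sInf {x : ℝ | t ≤ ProbabilityTheory.cdf μ x}
    max (derivWithin (ProbabilityTheory.cdf μ) (Iio q) q)
      (derivWithin (ProbabilityTheory.cdf μ) (Ioi q) q)
  else 0

/-- The `n`-fold product `μⁿ`, as a measure on `ℝⁿ` with the Euclidean distance. -/
def productMeasure (μ : Measure ℝ) (n : ℕ) : Measure (EuclideanSpace ℝ (Fin n)) :=
  (Measure.pi fun _ : Fin n => μ).map (WithLp.toLp 2)

/-- The boundary measure `ν_s(∂A) = liminf_{h → 0⁺} ν(A_h \ A) / h`, where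
`A_h = {x | d(x, A) ≤ h}` is the closed enlargement (empty if `A` is empty). -/
def boundaryMeasure {n : ℕ} (ν : Measure (EuclideanSpace ℝ (Fin n)))
    (A : Set (EuclideanSpace ℝ (Fin n))) : ENNReal :=
  liminf (fun h : ℝ => ν (Metric.cthickening h A \ A) / ENNReal.ofReal h) (𝓝[>] 0)

/-- The constant `κ₁ = 2√6`. -/
def kappa₁ : ℝ := 2 * √6

/-- The constant `κ₂ = 2(1 + 2√6)`. -/
def kappa₂ : ℝ := 2 * (1 + 2 * √6)

end

/-! Put `m = min (μⁿ(A), 1 - μⁿ(A))`, `t = m / (2nκ₂)`, and let `r` be the quantile with `F_μ(-r) =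
t`. Since the logarithm of the tail `T` is convex, its rate of decay is smallest far out: on `[0,
r]` it is at least its value at `r`, which is `c = J_μ(t) / t`. Thus `μ` dominates the density `c T`
on `[0, r]`, and with Fubini this gives an `L¹` Hardy inequality with constant `c` for `μ`
conditioned to `[-r, r]` (`hardyInequality_cond`).

Hardy's inequality for `(f - f(0))²` yields Bobkov's functional inequality with profile `p(1 - p)`
and constant `4 / c` (`HardyInequality.bobkovInequality`). That form tensorises without loss in the
dimension (`BobkovInequality.pi`); smooth cutoffs of `A` turn it into a bound on enlargements
(`BobkovInequality.mul_le_enlargement`).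

The cube `[-r, r]ⁿ` misses mass at most `2nt = m / κ₂`, a small fraction of `m`, so the bound for
the conditioned product returns to `μⁿ` (`mul_le_real_enlargement`). The choice of `t` makes `c m /
(2κ₁)` equal to the claimed right-hand side. -/

/-! ### Bobkov's functional inequality and its tensorisation. -/

/-- A probability measure `ν` on the line satisfies Bobkov's functional inequality, with
`I p = p (1 - p)` and with constant `a`. -/
def BobkovInequality (ν : Measure ℝ) (a : ℝ) : Prop :=
  ∀ f : ℝ → ℝ, Differentiable ℝ f → (∃ K, ∀ x, ‖deriv f x‖ ≤ K) → (∀ x, f x ∈ Icc (0 : ℝ) 1) →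
    (∫ x, f x ∂ν) * (1 - ∫ x, f x ∂ν) ≤
      ∫ x, √((f x * (1 - f x)) ^ 2 + (a * deriv f x) ^ 2) ∂ν

/-- The linear inclusion of `Fin n → ℝ` into `Fin (n + 1) → ℝ` with vanishing first coordinate. -/
noncomputable def consZero (n : ℕ) : (Fin n → ℝ) →L[ℝ] (Fin (n + 1) → ℝ) :=
  ContinuousLinearMap.pi (Fin.cases 0 fun i => ContinuousLinearMap.proj i)

lemma consZero_single {n : ℕ} (i : Fin n) :
    consZero n (Pi.single i 1) = Pi.single i.succ 1 := by
  ext j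
  refine Fin.cases ?_ (fun k => ?_) j
  · simp [consZero, (Fin.succ_ne_zero i).symm]
  · simp [consZero, Pi.single_apply]

lemma hasFDerivAt_cons_right {n : ℕ} (x : ℝ) (y : Fin n → ℝ) :
    HasFDerivAt (fun y : Fin n → ℝ => (Fin.cons x y : Fin (n + 1) → ℝ)) (consZero n) y := by
  rw [hasFDerivAt_pi']
  intro j
  refine Fin.cases ?_ (fun k => ?_) j
  · simpa [consZero] using hasFDerivAt_const x y
  · simpa [consZero] using hasFDerivAt_apply k y

lemma hasDerivAt_cons_left {n : ℕ} (x : ℝ) (y : Fin n → ℝ) :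
    HasDerivAt (fun x : ℝ => (Fin.cons x y : Fin (n + 1) → ℝ)) (Pi.single 0 1) x := by
  rw [hasDerivAt_pi]
  intro j
  refine Fin.cases ?_ (fun k => ?_) j
  · exact hasDerivAt_id x
  · simpa [Pi.single_apply] using hasDerivAt_const x (y k)

lemma measurable_cons {n : ℕ} :
    Measurable fun p : ℝ × (Fin n → ℝ) => (Fin.cons p.1 p.2 : Fin (n + 1) → ℝ) := by
  rw [measurable_pi_iff]
  intro j
  refine Fin.cases ?_ (fun k => ?_) j
  · exact measurable_fst
  · exact (measurable_pi_apply k).comp measurable_snd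

lemma integral_pi_succ (ν : Measure ℝ) [IsProbabilityMeasure ν] {n : ℕ}
    (F : (Fin (n + 1) → ℝ) → ℝ) (hF : Integrable F (Measure.pi fun _ => ν)) :
    ∫ z, F z ∂(Measure.pi fun _ => ν) =
      ∫ y, ∫ x, F (Fin.cons x y) ∂ν ∂(Measure.pi fun _ : Fin n => ν) := by
  have h := (measurePreserving_piFinSuccAbove (fun _ : Fin (n + 1) => ν) 0).symm
  have hI := (h.integrable_comp_emb (MeasurableEquiv.measurableEmbedding _)).2 hF
  rw [← h.integral_comp']
  exact (integral_prod_symm _ hI).trans (by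
    simp [MeasurableEquiv.piFinSuccAbove_symm_apply, Fin.insertNthEquiv])

/-- The norm of a vector-valued integral is at most the integral of the norm, for the vector `(u,
v₁, …, vₙ)`. This is the Minkowski step of the tensorisation. -/
lemma sqrt_add_sum_sq_integral_le {α : Type*} [MeasurableSpace α] {ν : Measure α} {n : ℕ}
    (u : α → ℝ) (v : Fin n → α → ℝ) (hu : Integrable u ν) (hv : ∀ i, Integrable (v i) ν) :
    √((∫ x, u x ∂ν) ^ 2 + ∑ i, (∫ x, v i x ∂ν) ^ 2) ≤
      ∫ x, √(u x ^ 2 + ∑ i, v i x ^ 2) ∂ν := by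
  let w : α → EuclideanSpace ℝ (Fin (n + 1)) := fun x => WithLp.toLp 2 (Fin.cons (u x) (v · x))
  have hw : Integrable w ν := by
    have : Integrable (fun x => (Fin.cons (u x) (v · x) : Fin (n + 1) → ℝ)) ν := by
      rw [integrable_pi_iff]
      intro j
      refine Fin.cases ?_ (fun k => ?_) j
      · simpa using hu
      · simpa using hv k
    exact ((EuclideanSpace.equiv (Fin (n + 1)) ℝ).symm.toContinuousLinearMap).integrable_comp this
  have hcoord : ∀ j, (∫ x, w x ∂ν) j = ∫ x, w x j ∂ν := fun j =>
    ((EuclideanSpace.proj (𝕜 := ℝ) j).integral_comp_comm hw).symm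
  have h := norm_integral_le_integral_norm (μ := ν) w
  rw [EuclideanSpace.norm_eq, Fin.sum_univ_succ] at h
  simp only [hcoord, EuclideanSpace.norm_eq, Fin.sum_univ_succ, Real.norm_eq_abs, sq_abs] at h
  simpa [w] using h

lemma integrable_of_mem_Icc {α : Type*} [MeasurableSpace α] {ν : Measure α} [IsFiniteMeasure ν]
    {f : α → ℝ} (hf : Measurable f) (h01 : ∀ x, f x ∈ Icc (0 : ℝ) 1) : Integrable f ν :=
  Integrable.of_bound hf.aestronglyMeasurable 1 (ae_of_all _ fun x => by
    rw [Real.norm_eq_abs, abs_le]; exact ⟨by linarith [(h01 x).1], (h01 x).2⟩)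

lemma integral_mem_Icc {α : Type*} [MeasurableSpace α] {ν : Measure α} [IsProbabilityMeasure ν]
    {f : α → ℝ} (hf : Measurable f) (h01 : ∀ x, f x ∈ Icc (0 : ℝ) 1) :
    ∫ x, f x ∂ν ∈ Icc (0 : ℝ) 1 := by
  refine ⟨integral_nonneg fun x => (h01 x).1, ?_⟩
  calc ∫ x, f x ∂ν ≤ ∫ _, (1 : ℝ) ∂ν :=
        integral_mono (integrable_of_mem_Icc hf h01) (integrable_const _) fun x => (h01 x).2
    _ = 1 := by simp

lemma mul_one_sub_mem_Icc {p : ℝ} (hp : p ∈ Icc (0 : ℝ) 1) : p * (1 - p) ∈ Icc (0 : ℝ) (1 / 4) :=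
  ⟨mul_nonneg hp.1 (by linarith [hp.2]), by nlinarith [sq_nonneg (p - 1 / 2)]⟩

lemma integrable_sqrt_sq_add {α : Type*} [MeasurableSpace α] {ν : Measure α} [IsFiniteMeasure ν]
    {u v : α → ℝ} (hu : Measurable u) (hv : Measurable v) {K : ℝ}
    (hb : ∀ x, u x ^ 2 + v x ≤ K) : Integrable (fun x => √(u x ^ 2 + v x)) ν := by
  refine Integrable.of_bound ((hu.pow_const 2).add hv).sqrt.aestronglyMeasurable (√K)
    (ae_of_all _ fun x => ?_)
  rw [Real.norm_eq_abs, abs_of_nonneg (Real.sqrt_nonneg _)]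
  exact Real.sqrt_le_sqrt (hb x)

/-- The partial average over the first coordinate is differentiable. -/
lemma hasFDerivAt_integral_cons {ν : Measure ℝ} [IsProbabilityMeasure ν] {n : ℕ}
    {f : (Fin (n + 1) → ℝ) → ℝ} (hf : Differentiable ℝ f) {K : ℝ} (hK : ∀ x, ‖fderiv ℝ f x‖ ≤ K)
    (h01 : ∀ x, f x ∈ Icc (0 : ℝ) 1) (y : Fin n → ℝ) :
    HasFDerivAt (fun y : Fin n → ℝ => ∫ x, f (Fin.cons x y) ∂ν)
      (∫ x, (fderiv ℝ f (Fin.cons x y)).comp (consZero n) ∂ν) y := by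
  have hm : ∀ y : Fin n → ℝ, Measurable fun x : ℝ => (Fin.cons x y : Fin (n + 1) → ℝ) := fun y =>
    measurable_cons.comp (measurable_id.prodMk measurable_const)
  refine hasFDerivAt_integral_of_dominated_of_fderiv_le (s := univ) (bound := fun _ => K * ‖consZero n‖)
    (F' := fun y x => (fderiv ℝ f (Fin.cons x y)).comp (consZero n)) univ_mem ?_ ?_ ?_ ?_ ?_ ?_
  · exact Eventually.of_forall fun y =>
      (hf.continuous.measurable.comp (hm y)).aestronglyMeasurable
  · exact integrable_of_mem_Icc (hf.continuous.measurable.comp (hm y)) fun x => h01 _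
  · have h1 : Measurable fun x : ℝ => fderiv ℝ f (Fin.cons x y) :=
      (measurable_fderiv ℝ f).comp (hm y)
    have h2 : Continuous fun L : (Fin (n + 1) → ℝ) →L[ℝ] ℝ => L.comp (consZero n) := by fun_prop
    exact (h2.measurable.comp h1).aestronglyMeasurable
  · refine ae_of_all _ fun x y _ => (ContinuousLinearMap.opNorm_comp_le _ _).trans ?_
    gcongr
    exact hK _
  · exact integrable_const _
  · exact ae_of_all _ fun x y _ =>
      (hf (Fin.cons x y)).hasFDerivAt.comp y (hasFDerivAt_cons_right x y)

/-- Bobkov's functional inequality is stable under products. -/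
theorem BobkovInequality.pi {ν : Measure ℝ} [IsProbabilityMeasure ν] {a : ℝ}
    (h : BobkovInequality ν a) (n : ℕ) :
    ∀ f : (Fin n → ℝ) → ℝ, Differentiable ℝ f → (∃ K, ∀ x, ‖fderiv ℝ f x‖ ≤ K) →
      (∀ x, f x ∈ Icc (0 : ℝ) 1) →
      (∫ x, f x ∂(Measure.pi fun _ => ν)) * (1 - ∫ x, f x ∂(Measure.pi fun _ => ν)) ≤
        ∫ x, √((f x * (1 - f x)) ^ 2 + ∑ i, (a * fderiv ℝ f x (Pi.single i 1)) ^ 2)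
          ∂(Measure.pi fun _ => ν) := by
  induction n with
  | zero =>
    intro f _ _ h01
    have hI : ∀ F : (Fin 0 → ℝ) → ℝ, ∫ x, F x ∂(Measure.pi fun _ => ν) = F 0 := by
      intro F
      have : F = fun _ => F 0 := by ext x; rw [Subsingleton.elim x 0]
      rw [this]
      simp
    rw [hI, hI]
    simp only [Finset.univ_eq_empty, Finset.sum_empty, add_zero]
    rw [Real.sqrt_sq (mul_one_sub_mem_Icc (h01 0)).1]
  | succ n ih =>
    rintro f hf ⟨K, hK⟩ h01
    have hK0 : 0 ≤ K := (norm_nonneg _).trans (hK 0)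
    have hm : ∀ y : Fin n → ℝ, Measurable fun x : ℝ => (Fin.cons x y : Fin (n + 1) → ℝ) := fun y =>
      measurable_cons.comp (measurable_id.prodMk measurable_const)
    have hfm := hf.continuous.measurable
    set g : (Fin n → ℝ) → ℝ := fun y => ∫ x, f (Fin.cons x y) ∂ν with hg
    have hg' := hasFDerivAt_integral_cons (ν := ν) hf hK h01
    have hg01 : ∀ y, g y ∈ Icc (0 : ℝ) 1 := fun y =>
      integral_mem_Icc (hfm.comp (hm y)) fun x => h01 _
    have hpart : ∀ j : Fin (n + 1), Measurable fun z => fderiv ℝ f z (Pi.single j 1) := fun j =>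
      measurable_fderiv_apply_const ℝ f _
    have hpartK : ∀ (j : Fin (n + 1)) z, |fderiv ℝ f z (Pi.single j 1)| ≤ K := fun j z => by
      have := (fderiv ℝ f z).le_opNorm (Pi.single j 1)
      rw [Pi.norm_single, norm_one, mul_one] at this
      exact this.trans (hK z)
    have hpartI : ∀ (j : Fin (n + 1)) (y : Fin n → ℝ),
        Integrable (fun x => a * fderiv ℝ f (Fin.cons x y) (Pi.single j 1)) ν := fun j y =>
      (Integrable.of_bound ((hpart j).comp (hm y)).aestronglyMeasurable K
        (ae_of_all _ fun x => hpartK j _)).const_mul a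
    have hgK : ∀ y, ‖fderiv ℝ g y‖ ≤ K * ‖consZero n‖ := fun y => by
      rw [(hg' y).fderiv]
      refine (norm_integral_le_of_norm_le_const (C := K * ‖consZero n‖)
        (ae_of_all _ fun x => (ContinuousLinearMap.opNorm_comp_le _ _).trans ?_)).trans (by simp)
      gcongr
      exact hK _
    have hgpart : ∀ y (i : Fin n), a * fderiv ℝ g y (Pi.single i 1) =
        ∫ x, a * fderiv ℝ f (Fin.cons x y) (Pi.single i.succ 1) ∂ν := fun y i => by
      rw [(hg' y).fderiv, integral_const_mul, ContinuousLinearMap.integral_apply]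
      · simp [consZero_single]
      · have h1 : Measurable fun x : ℝ => fderiv ℝ f (Fin.cons x y) :=
          (measurable_fderiv ℝ f).comp (hm y)
        have h2 : Continuous fun L : (Fin (n + 1) → ℝ) →L[ℝ] ℝ => L.comp (consZero n) := by fun_prop
        refine Integrable.of_bound (h2.measurable.comp h1).aestronglyMeasurable (K * ‖consZero n‖)
          (ae_of_all _ fun x => (ContinuousLinearMap.opNorm_comp_le _ _).trans ?_)
        gcongr
        exact hK _
    have hIsq : ∀ z, (f z * (1 - f z)) ^ 2 ≤ 1 := fun z => by
      have := mul_one_sub_mem_Icc (h01 z)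
      nlinarith [this.1, this.2]
    have hasq : ∀ (j : Fin (n + 1)) z, (a * fderiv ℝ f z (Pi.single j 1)) ^ 2 ≤ (a * K) ^ 2 := by
      intro j z
      rw [mul_pow, mul_pow]
      exact mul_le_mul_of_nonneg_left (sq_le_sq.2 (by rw [abs_of_nonneg hK0]; exact hpartK j z))
        (sq_nonneg a)
    have hIm : Measurable fun z => f z * (1 - f z) := hfm.mul (measurable_const.sub hfm)
    have hsm : Measurable fun z => ∑ i : Fin (n + 1), (a * fderiv ℝ f z (Pi.single i 1)) ^ 2 :=
      Finset.measurable_sum _ fun i _ => ((hpart i).const_mul a).pow_const 2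
    have hbound : ∀ z, (f z * (1 - f z)) ^ 2 + ∑ i : Fin (n + 1),
        (a * fderiv ℝ f z (Pi.single i 1)) ^ 2 ≤ 1 + ∑ _i : Fin (n + 1), (a * K) ^ 2 := fun z =>
      add_le_add (hIsq z) (Finset.sum_le_sum fun i _ => hasq i z)
    have hint : Integrable (fun z => √((f z * (1 - f z)) ^ 2 +
        ∑ i : Fin (n + 1), (a * fderiv ℝ f z (Pi.single i 1)) ^ 2)) (Measure.pi fun _ => ν) :=
      integrable_sqrt_sq_add hIm hsm hbound
    -- The one-dimensional inequality on each fibre; it bounds the profile of the partial average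
    -- `g`, to which the induction hypothesis is applied.
    have hone : ∀ y, g y * (1 - g y) ≤
        ∫ x, √((f (Fin.cons x y) * (1 - f (Fin.cons x y))) ^ 2 +
          (a * fderiv ℝ f (Fin.cons x y) (Pi.single 0 1)) ^ 2) ∂ν := fun y => by
      have hd : ∀ x, HasDerivAt (fun x : ℝ => f (Fin.cons x y))
          (fderiv ℝ f (Fin.cons x y) (Pi.single 0 1)) x := fun x =>
        (hf (Fin.cons x y)).hasFDerivAt.comp_hasDerivAt x (hasDerivAt_cons_left x y)
      have := h (fun x => f (Fin.cons x y)) (fun x => (hd x).differentiableAt)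
        ⟨K, fun x => by rw [(hd x).deriv]; exact hpartK 0 _⟩ (fun x => h01 _)
      simpa only [(hd _).deriv] using this
    rw [integral_pi_succ ν f (integrable_of_mem_Icc hfm h01), integral_pi_succ ν _ hint]
    refine (ih g (fun y => (hg' y).differentiableAt) ⟨_, hgK⟩ hg01).trans ?_
    refine integral_mono_of_nonneg (ae_of_all _ fun y => Real.sqrt_nonneg _) ?_
      (ae_of_all _ fun y => ?_)
    · have h' := (measurePreserving_piFinSuccAbove (fun _ : Fin (n + 1) => ν) 0).symm
      have hI := (h'.integrable_comp_emb (MeasurableEquiv.measurableEmbedding _)).2 hint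
      simpa [MeasurableEquiv.piFinSuccAbove_symm_apply, Fin.insertNthEquiv] using
        hI.integral_prod_right
    · set u : ℝ → ℝ := fun x => √((f (Fin.cons x y) * (1 - f (Fin.cons x y))) ^ 2 +
          (a * fderiv ℝ f (Fin.cons x y) (Pi.single 0 1)) ^ 2) with hu
      have huI : Integrable u ν := integrable_sqrt_sq_add (hIm.comp (hm y))
        ((((hpart 0).comp (hm y)).const_mul a).pow_const 2)
        fun x => add_le_add (hIsq _) (hasq 0 _)
      calc √((g y * (1 - g y)) ^ 2 + ∑ i, (a * fderiv ℝ g y (Pi.single i 1)) ^ 2)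
          ≤ √((∫ x, u x ∂ν) ^ 2 + ∑ i : Fin n,
              (∫ x, a * fderiv ℝ f (Fin.cons x y) (Pi.single i.succ 1) ∂ν) ^ 2) := by
            simp only [hgpart]
            apply Real.sqrt_le_sqrt
            gcongr
            · exact (mul_one_sub_mem_Icc (hg01 y)).1
            · exact hone y
        _ ≤ _ := sqrt_add_sum_sq_integral_le u _ huI fun i => hpartI i.succ y
        _ = _ := by
            refine integral_congr_ae (ae_of_all _ fun x => ?_)
            simp only [hu]
            -- Squaring the fibre integrand `u` restores the profile term and the first partial
            -- derivative, so the Euclidean norm of the whole gradient reassembles.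
            rw [Real.sq_sqrt (by positivity), Fin.sum_univ_succ, add_assoc]

/-! ### From Hardy's inequality to Bobkov's inequality. -/

/-- The measure `ν` satisfies the `L¹` Hardy inequality about `0` with constant `c`. -/
def HardyInequality (ν : Measure ℝ) (c : ℝ) : Prop :=
  ∀ G : ℝ → ℝ, Differentiable ℝ G → (∃ K, ∀ x, ‖deriv G x‖ ≤ K) → G 0 = 0 →
    ENNReal.ofReal c * ∫⁻ x, ‖G x‖ₑ ∂ν ≤ ∫⁻ x, ‖deriv G x‖ₑ ∂ν

/-- For `u ≤ 2`, use `g u ≤ g² + u² / 4` and the quadratic growth of the root; for `u ≥ 2` the root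
is at least `u`, and `g ≤ 1` suffices. The number `1 / 4` is the maximum of `p(1 - p)`. -/
lemma mul_le_sq_add_sqrt {g u : ℝ} (hg1 : g ≤ 1) (hu : 0 ≤ u) :
    g * u ≤ g ^ 2 + (√((1 / 4) ^ 2 + u ^ 2) - 1 / 4) := by
  rcases le_total u 2 with h | h
  · have : 1 / 4 + u ^ 2 / 4 ≤ √((1 / 4) ^ 2 + u ^ 2) := by
      apply Real.le_sqrt_of_sq_le
      have : u ^ 2 ≤ 4 := by nlinarith
      nlinarith [sq_nonneg u]
    nlinarith [sq_nonneg (g - u / 2)]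
  · have : u ≤ √((1 / 4) ^ 2 + u ^ 2) := Real.le_sqrt_of_sq_le (by norm_num)
    nlinarith

lemma sqrt_sq_add_sub_antitone {a b s : ℝ} (hab : a ≤ b) (hs : 0 ≤ s) :
    √(b ^ 2 + s) - b ≤ √(a ^ 2 + s) - a := by
  have : √(b ^ 2 + s) ≤ √(a ^ 2 + s) + (b - a) := by
    apply Real.sqrt_le_iff.2
    have h1 := Real.sqrt_nonneg (a ^ 2 + s)
    have h2 := Real.sq_sqrt (show 0 ≤ a ^ 2 + s by positivity)
    have h3 : a ≤ √(a ^ 2 + s) := Real.le_sqrt_of_sq_le (by linarith)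
    exact ⟨by linarith, by nlinarith⟩
  linarith

lemma lintegral_enorm_eq_ofReal_integral_abs {α : Type*} [MeasurableSpace α] {ν : Measure α}
    {f : α → ℝ} (hf : Integrable f ν) : ∫⁻ x, ‖f x‖ₑ ∂ν = ENNReal.ofReal (∫ x, |f x| ∂ν) := by
  rw [ofReal_integral_eq_lintegral_ofReal hf.abs (ae_of_all _ fun x => abs_nonneg _)]
  simp [Real.enorm_eq_ofReal_abs]

/-- Apply Hardy to `(f - f(0))²`. The splitting `mul_le_sq_add_sqrt` returns half of the left side,
which is absorbed; then `1 / 4` is lowered to `f(1 - f)`, because `s ↦ √(s² + v) - s` decreases. -/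
theorem HardyInequality.bobkovInequality {ν : Measure ℝ} [IsProbabilityMeasure ν] {c : ℝ}
    (hc : 0 < c) (h : HardyInequality ν c) : BobkovInequality ν (4 / c) := by
  rintro f hf ⟨K, hK⟩ h01
  have hfm := hf.continuous.measurable
  have hf'm := measurable_deriv f
  have hfI : Integrable f ν := integrable_of_mem_Icc hfm h01
  have hg1 : ∀ x, |f x - f 0| ≤ 1 := fun x => by
    rw [abs_le]
    constructor <;> linarith [(h01 x).1, (h01 x).2, (h01 0).1, (h01 0).2]
  have hd : ∀ x, HasDerivAt (fun x => (f x - f 0) ^ 2) (2 * (f x - f 0) * deriv f x) x := fun x => by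
    have := ((hf x).hasDerivAt.sub_const (f 0)).fun_pow 2
    simpa using this
  have hb : ∀ x, ‖2 * (f x - f 0) * deriv f x‖ ≤ 2 * K := fun x => by
    rw [norm_mul, norm_mul, Real.norm_two, Real.norm_eq_abs (f x - f 0)]
    have := hK x
    have := norm_nonneg (deriv f x)
    nlinarith [hg1 x, abs_nonneg (f x - f 0)]
  have hH := h _ (fun x => (hd x).differentiableAt) ⟨2 * K, fun x => (hd x).deriv ▸ hb x⟩ (by simp)
  have hgsq : ∀ x, (f x - f 0) ^ 2 ≤ 1 := fun x => by
    rw [← sq_abs]; exact pow_le_one₀ (abs_nonneg _) (hg1 x)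
  have hgI : Integrable (fun x => (f x - f 0) ^ 2) ν :=
    integrable_of_mem_Icc ((hfm.sub_const _).pow_const 2) fun x => ⟨sq_nonneg _, hgsq x⟩
  have hG'I : Integrable (fun x => 2 * (f x - f 0) * deriv f x) ν :=
    Integrable.of_bound (((hfm.sub_const _).const_mul 2).mul hf'm).aestronglyMeasurable _
      (ae_of_all _ hb)
  simp only [(hd _).deriv] at hH
  rw [lintegral_enorm_eq_ofReal_integral_abs hgI, lintegral_enorm_eq_ofReal_integral_abs hG'I,
    ← ENNReal.ofReal_mul hc.le,
    ENNReal.ofReal_le_ofReal_iff (integral_nonneg fun x => abs_nonneg _)] at hH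
  simp only [abs_pow, sq_abs] at hH
  have hK0 : 0 ≤ K := (norm_nonneg _).trans (hK 0)
  have haK : ∀ x, (4 / c * deriv f x) ^ 2 ≤ (4 / c * K) ^ 2 := fun x => by
    rw [mul_pow, mul_pow]
    exact mul_le_mul_of_nonneg_left (sq_le_sq.2 (by rw [abs_of_nonneg hK0]; exact hK x))
      (sq_nonneg _)
  have hIm : Measurable fun x => f x * (1 - f x) := hfm.mul (measurable_const.sub hfm)
  have hIsq : ∀ x, (f x * (1 - f x)) ^ 2 ≤ 1 := fun z => by
    have := mul_one_sub_mem_Icc (h01 z)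
    nlinarith [this.1, this.2]
  have hsI : Integrable (fun x => √((f x * (1 - f x)) ^ 2 + (4 / c * deriv f x) ^ 2)) ν :=
    integrable_sqrt_sq_add hIm ((hf'm.const_mul _).pow_const 2)
      fun x => add_le_add (hIsq x) (haK x)
  have htI : Integrable (fun x => √((1 / 4 : ℝ) ^ 2 + (4 / c * deriv f x) ^ 2)) ν :=
    integrable_sqrt_sq_add (u := fun _ => 1 / 4) measurable_const ((hf'm.const_mul _).pow_const 2)
      fun x => add_le_add le_rfl (haK x)
  have htI' : Integrable (fun x => √((1 / 4 : ℝ) ^ 2 + (4 / c * deriv f x) ^ 2) - 1 / 4) ν :=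
    htI.sub (integrable_const _)
  have hfsqI : Integrable (fun x => f x * (1 - f x)) ν :=
    integrable_of_mem_Icc hIm fun x => ⟨(mul_one_sub_mem_Icc (h01 x)).1,
      (mul_one_sub_mem_Icc (h01 x)).2.trans (by norm_num)⟩
  have hpt : ∀ x, |2 * (f x - f 0) * deriv f x| ≤
      c / 2 * ((f x - f 0) ^ 2 + (√((1 / 4 : ℝ) ^ 2 + (4 / c * deriv f x) ^ 2) - 1 / 4)) := by
    intro x
    have := mul_le_sq_add_sqrt (hg1 x) (abs_nonneg (4 / c * deriv f x))
    rw [sq_abs, sq_abs] at this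
    calc |2 * (f x - f 0) * deriv f x|
        = c / 2 * (|f x - f 0| * |4 / c * deriv f x|) := by
          rw [abs_mul, abs_mul, abs_mul, abs_div, abs_of_pos hc]
          norm_num
          field_simp
          ring
      _ ≤ _ := by gcongr
  have h1 : c * ∫ x, (f x - f 0) ^ 2 ∂ν ≤ c / 2 * (∫ x, (f x - f 0) ^ 2 ∂ν +
      ∫ x, (√((1 / 4 : ℝ) ^ 2 + (4 / c * deriv f x) ^ 2) - 1 / 4) ∂ν) := by
    refine hH.trans ?_
    rw [← integral_add hgI htI', ← integral_const_mul]
    exact integral_mono hG'I.abs ((hgI.add htI').const_mul _) hpt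
  have h2 : ∫ x, (f x - f 0) ^ 2 ∂ν ≤
      ∫ x, (√((1 / 4 : ℝ) ^ 2 + (4 / c * deriv f x) ^ 2) - 1 / 4) ∂ν := by
    nlinarith
  have h3 : ∫ x, (√((1 / 4 : ℝ) ^ 2 + (4 / c * deriv f x) ^ 2) - 1 / 4) ∂ν ≤
      ∫ x, √((f x * (1 - f x)) ^ 2 + (4 / c * deriv f x) ^ 2) ∂ν - ∫ x, f x * (1 - f x) ∂ν := by
    rw [← integral_sub hsI hfsqI]
    refine integral_mono htI' (hsI.sub hfsqI) fun x => ?_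
    have := mul_one_sub_mem_Icc (h01 x)
    exact sqrt_sq_add_sub_antitone this.2 (sq_nonneg _)
  have h4 : ∫ x, (f x - f 0) ^ 2 ∂ν =
      (∫ x, f x ∂ν) * (1 - 2 * f 0) + f 0 ^ 2 - ∫ x, f x * (1 - f x) ∂ν := by
    have : ∀ x, (f x - f 0) ^ 2 = f x * (1 - 2 * f 0) + f 0 ^ 2 - f x * (1 - f x) := fun x => by ring
    have hI : Integrable (fun x => f x * (1 - 2 * f 0) + f 0 ^ 2) ν :=
      (hfI.mul_const _).add (integrable_const _)
    simp only [this]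
    rw [integral_sub hI hfsqI,
      integral_add (hfI.mul_const _) (integrable_const _), integral_mul_const]
    simp
  -- `∫ (f - f(0))²` is at least the variance of `f`, and for `I p = p(1 - p)` the variance is
  -- exactly `I(∫ f) - ∫ I(f)`.
  nlinarith [sq_nonneg (∫ x, f x ∂ν - f 0)]

/-! ### Smooth cutoffs. -/

open scoped Convolution in
/-- A smooth approximation of the indicator function of `A`, supported in an enlargement of `A`. -/
lemma exists_smooth_cutoff {n : ℕ} {A : Set (EuclideanSpace ℝ (Fin n))} (hA : A.Nonempty)
    {h δ : ℝ} (hδ : 0 < δ) (hh : 2 * δ < h) :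
    ∃ f : EuclideanSpace ℝ (Fin n) → ℝ, Differentiable ℝ f ∧
      (∀ x, ‖fderiv ℝ f x‖ ≤ 1 / (h - 2 * δ)) ∧ (∀ x, f x ∈ Icc (0 : ℝ) 1) ∧
      (∀ x ∈ A, f x = 1) ∧ ∀ x ∉ Metric.cthickening h A, f x = 0 := by
  set L : ℝ := 1 / (h - 2 * δ) with hL
  have hL0 : 0 < L := by rw [hL]; exact one_div_pos.2 (by linarith)
  -- A piecewise linear cutoff, equal to `1` up to distance `δ` from `A` and to `0` beyond `h - δ`.
  -- Mollifying at scale `δ` keeps the Lipschitz constant and uses up the two margins.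
  set g : EuclideanSpace ℝ (Fin n) → ℝ :=
    fun x => max 0 (min 1 (L * (h - δ - Metric.infDist x A))) with hg
  have hg01 : ∀ x, g x ∈ Icc (0 : ℝ) 1 := fun x =>
    ⟨le_max_left _ _, max_le zero_le_one (min_le_left _ _)⟩
  have hgL : ∀ x y, |g x - g y| ≤ L * dist x y := fun x y => by
    have h1 : |g x - g y| ≤ |L * (h - δ - Metric.infDist x A) - L * (h - δ - Metric.infDist y A)| := by
      refine (abs_max_sub_max_le_max _ _ _ _).trans ?_
      rw [sub_self, abs_zero, max_eq_right (abs_nonneg _)]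
      refine (abs_min_sub_min_le_max _ _ _ _).trans ?_
      rw [sub_self, abs_zero, max_eq_right (abs_nonneg _)]
    refine h1.trans ?_
    rw [← mul_sub, abs_mul, abs_of_pos hL0]
    gcongr
    have := (Metric.lipschitz_infDist_pt A).dist_le_mul x y
    rw [Real.dist_eq, NNReal.coe_one, one_mul] at this
    rw [show h - δ - Metric.infDist x A - (h - δ - Metric.infDist y A) =
      -(Metric.infDist x A - Metric.infDist y A) by ring, abs_neg]
    exact this
  have hgc : Continuous g := by
    have := Metric.continuous_infDist_pt A
    fun_prop
  let φ : ContDiffBump (0 : EuclideanSpace ℝ (Fin n)) := ⟨δ / 2, δ, by positivity, by linarith⟩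
  set f : EuclideanSpace ℝ (Fin n) → ℝ := φ.normed volume ⋆[ContinuousLinearMap.lsmul ℝ ℝ, volume] g
  have hfe : ∀ x, f x = ∫ t, φ.normed volume t * g (x - t) := fun x => rfl
  have hφI : Integrable (φ.normed volume) volume := φ.integrable_normed
  have hI : ∀ x, Integrable (fun t => φ.normed volume t * g (x - t)) volume := fun x => by
    refine hφI.mul_bdd (c := 1) ((hgc.comp (by fun_prop)).aestronglyMeasurable)
      (ae_of_all _ fun t => ?_)
    rw [Real.norm_eq_abs, abs_of_nonneg (hg01 _).1]
    exact (hg01 _).2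
  have hfL : ∀ x y, |f x - f y| ≤ L * dist x y := fun x y => by
    rw [hfe, hfe, ← integral_sub (hI x) (hI y), ← Real.norm_eq_abs]
    calc ‖∫ t, (φ.normed volume t * g (x - t) - φ.normed volume t * g (y - t))‖
        ≤ ∫ t, φ.normed volume t * (L * dist x y) := by
          refine norm_integral_le_of_norm_le (hφI.mul_const _) (ae_of_all _ fun t => ?_)
          rw [← mul_sub, norm_mul, Real.norm_eq_abs, Real.norm_eq_abs,
            abs_of_nonneg (φ.nonneg_normed t)]
          refine mul_le_mul_of_nonneg_left ?_ (φ.nonneg_normed t)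
          simpa using hgL (x - t) (y - t)
      _ = L * dist x y := by rw [integral_mul_const, φ.integral_normed, one_mul]
  have hball : ∀ x b, (∀ y, dist y x < δ → g y = b) → f x = b := fun x b hb => by
    have : dist (f x) b ≤ 0 := by
      have hb' : g x = b := hb x (by simpa using hδ)
      rw [← hb']
      refine ContDiffBump.dist_normed_convolution_le hgc.aestronglyMeasurable fun y hy => ?_
      rw [hb', hb y hy, dist_self]
    simpa using this
  refine ⟨f, ?_, ?_, ?_, ?_, ?_⟩
  · have := φ.hasCompactSupport_normed (μ := volume) |>.contDiff_convolution_left (n := 1)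
      (ContinuousLinearMap.lsmul ℝ ℝ) φ.contDiff_normed (hgc.locallyIntegrable (μ := volume))
    exact this.differentiable (by simp)
  · intro x
    refine norm_fderiv_le_of_lipschitz ℝ (C := ⟨L, hL0.le⟩) (LipschitzWith.of_dist_le_mul fun x y => ?_)
    exact hfL x y
  · intro x
    constructor
    · rw [hfe]
      exact integral_nonneg fun t => mul_nonneg (φ.nonneg_normed t) (hg01 _).1
    · rw [hfe, ← φ.integral_normed (μ := volume)]
      exact integral_mono (hI x) hφI fun t => mul_le_of_le_one_right (φ.nonneg_normed t) (hg01 _).2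
  · intro x hx
    refine hball x 1 fun y hy => ?_
    have h1 : Metric.infDist y A ≤ δ := (Metric.infDist_le_dist_of_mem hx).trans hy.le
    have h2 : 1 ≤ L * (h - δ - Metric.infDist y A) := by
      calc (1 : ℝ) = L * (h - 2 * δ) := by rw [hL]; field_simp [show h - 2 * δ ≠ 0 by linarith]
        _ ≤ _ := mul_le_mul_of_nonneg_left (by linarith) hL0.le
    simp only [hg]
    rw [min_eq_left h2, max_eq_right zero_le_one]
  · intro x hx
    refine hball x 0 fun y hy => ?_
    have h1 : h < Metric.infDist x A := by
      by_contra hcon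
      exact hx (Metric.mem_cthickening_iff.2 <|
        (ENNReal.le_ofReal_iff_toReal_le (Metric.infEDist_ne_top hA) (by linarith)).2 (not_lt.1 hcon))
    have h2 : Metric.infDist x A ≤ Metric.infDist y A + dist x y := Metric.infDist_le_infDist_add_dist
    rw [dist_comm] at h2
    simp only [hg]
    refine max_eq_left (min_le_of_right_le ?_)
    exact mul_nonpos_of_nonneg_of_nonpos hL0.le (by linarith)

/-! ### Tail decay and the Hardy inequality on a centered segment. -/

/-- The Stieltjes outer measure is the greatest one bounded by the length function, so comparison on
half-open intervals is enough. -/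
lemma StieltjesFunction.le_measure_of_Ioc_le (F : StieltjesFunction ℝ) {β : Measure ℝ}
    (h : ∀ a b, β (Ioc a b) ≤ ENNReal.ofReal (F b - F a)) : β ≤ F.measure := by
  intro s
  have : β.toOuterMeasure ≤ F.outer := by
    refine OuterMeasure.le_ofFunction.2 fun s => ?_
    rw [StieltjesFunction.length_eq]
    refine le_iInf fun a => le_iInf fun b => le_iInf fun hs => ?_
    have hbot : (botSet : Set ℝ) = ∅ := by ext x; simp [botSet]
    rw [hbot, sdiff_empty] at hs
    exact (measure_mono hs).trans (h a b)
  rw [StieltjesFunction.measure]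
  exact this s

lemma continuous_cdf {μ : Measure ℝ} [IsProbabilityMeasure μ] [NullSingletonClass μ] :
    Continuous (ProbabilityTheory.cdf μ) := by
  refine continuous_iff_continuousAt.2 fun x => ?_
  have hm := ProbabilityTheory.monotone_cdf μ
  rw [hm.continuousAt_iff_leftLim_eq_rightLim, StieltjesFunction.rightLim_eq]
  refine le_antisymm (hm.leftLim_le le_rfl) ?_
  have := (ProbabilityTheory.cdf μ).measure_singleton x
  rw [ProbabilityTheory.measure_cdf, measure_singleton] at this
  linarith [ENNReal.ofReal_eq_zero.1 this.symm]

lemma cdf_neg_eq {μ : Measure ℝ} [IsProbabilityMeasure μ] [NullSingletonClass μ]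
    (hsymm : μ.map (fun x : ℝ => -x) = μ) (x : ℝ) :
    ProbabilityTheory.cdf μ (-x) = 1 - ProbabilityTheory.cdf μ x := by
  rw [ProbabilityTheory.cdf_eq_real, ProbabilityTheory.cdf_eq_real,
    ← probReal_compl_eq_one_sub measurableSet_Iic, compl_Iic, measureReal_congr Ioi_ae_eq_Ici]
  conv_lhs => rw [← hsymm]
  rw [map_measureReal_apply measurable_neg measurableSet_Iic]
  congr 1
  ext y
  simp

/-- If the logarithm of the tail is convex, the slope at `r` bounds the decay of the tail on
`[0, r]`. -/
lemma tail_le_mul_exp {T : ℝ → ℝ} (hT : ConvexOn ℝ (Ici (0 : ℝ)) fun x => Real.log (T x)) {r c : ℝ}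
    (hr : 0 < r) (hpos : ∀ x ≤ r, 0 < T x)
    (hd : HasDerivWithinAt T (-(c * T r)) (Iio r) r ∨ HasDerivWithinAt T (-(c * T r)) (Ioi r) r)
    {a b : ℝ} (ha : 0 ≤ a) (hab : a ≤ b) (hb : b ≤ r) :
    T b ≤ T a * Real.exp (-c * (b - a)) := by
  have hTr := hpos r le_rfl
  have hint : r ∈ interior (Ici (0 : ℝ)) := by simpa using hr
  have hlog : ∀ s, HasDerivWithinAt T (-(c * T r)) s r →
      HasDerivWithinAt (fun x => Real.log (T x)) (-c) s r := fun s h => by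
    have := h.log hTr.ne'
    rwa [show -(c * T r) / T r = -c by field_simp] at this
  have hleft : derivWithin (fun x => Real.log (T x)) (Iio r) r ≤ -c := by
    -- Only the left derivative controls the chords ending at `r`; by convexity it is at most the
    -- right one, so either one-sided slope will do.
    rcases hd with h | h
    · rw [(hlog _ h).derivWithin (uniqueDiffWithinAt_Iio r)]
    · rw [← (hlog _ h).derivWithin (uniqueDiffWithinAt_Ioi r)]
      exact hT.leftDeriv_le_rightDeriv_of_mem_interior hint
  have hsl : ∀ x, 0 ≤ x → x < r → slope (fun x => Real.log (T x)) x r ≤ -c := fun x hx hxr =>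
    (hT.slope_le_leftDeriv_of_mem_interior hx hint hxr).trans hleft
  rcases hab.eq_or_lt with rfl | hab
  · simp
  have hslope : slope (fun x => Real.log (T x)) a b ≤ -c := by
    rcases hb.eq_or_lt with rfl | hb
    · exact hsl a ha hab
    · refine le_trans ?_ (hsl b (ha.trans hab.le) hb)
      rw [slope_def_field, slope_def_field]
      exact hT.slope_mono_adjacent ha hr.le hab hb
  rw [slope_def_field, div_le_iff₀ (by linarith)] at hslope
  rw [← Real.log_le_log_iff (hpos b hb) (mul_pos (hpos a (hab.le.trans hb)) (Real.exp_pos _)),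
    Real.log_mul (hpos a (hab.le.trans hb)).ne' (Real.exp_pos _).ne', Real.log_exp]
  linarith

/-- The exponential decay says that the upper right derivative of `T` is at most `-c T`. A
comparison principle for one-sided slopes integrates this, with no differentiability of `T`. -/
lemma integral_le_of_le_mul_exp {T : ℝ → ℝ} (hT : Continuous T) {r c : ℝ}
    (h : ∀ a b, 0 ≤ a → a ≤ b → b ≤ r → T b ≤ T a * Real.exp (-c * (b - a)))
    {a b : ℝ} (ha : 0 ≤ a) (hab : a ≤ b) (hb : b ≤ r) :
    ∫ s in a..b, c * T s ≤ T a - T b := by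
  have hB : ∀ x, HasDerivAt (fun x => T a - ∫ s in a..x, c * T s) (-(c * T x)) x := fun x => by
    have : Continuous fun s => c * T s := by fun_prop
    simpa using (this.integral_hasStrictDerivAt a x).hasDerivAt.const_sub (T a)
  have := image_le_of_liminf_slope_right_le_deriv_boundary (f := T) (a := a) (b := b)
    hT.continuousOn (B := fun x => T a - ∫ s in a..x, c * T s) (B' := fun x => -(c * T x)) (by simp)
    (fun x _ => (hB x).continuousAt.continuousWithinAt) (fun x _ => (hB x).hasDerivWithinAt) ?_
    (right_mem_Icc.2 hab)
  · linarith
  intro x hx ρ hρ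
  have hu : HasDerivAt (fun z => T x * Real.exp (-c * (z - x))) (-(c * T x)) x := by
    have h1 : HasDerivAt (fun z => -c * (z - x)) (-c * 1) x :=
      ((hasDerivAt_id x).sub_const x).const_mul (-c)
    have := (h1.exp).const_mul (T x)
    simpa [mul_comm] using this
  have htend := (hasDerivWithinAt_iff_tendsto_slope' (s := Ioi x) self_notMem_Ioi).1
    hu.hasDerivWithinAt
  refine Eventually.frequently ?_
  filter_upwards [htend.eventually_lt_const hρ, Ioo_mem_nhdsGT hx.2] with z hz hzb
  refine lt_of_le_of_lt ?_ hz
  rw [slope_def_field, slope_def_field]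
  have h2 := h x z (ha.trans hx.1) hzb.1.le (hzb.2.le.trans hb)
  have h3 : 0 < z - x := sub_pos.2 hzb.1
  gcongr
  simp

/-- A lower bound for a measure by a density on a segment. -/
lemma setLIntegral_density_le {μ : Measure ℝ} [IsProbabilityMeasure μ] [NullSingletonClass μ] {r c : ℝ}
    (hc : 0 ≤ c)
    (h : ∀ a b, 0 ≤ a → a ≤ b → b ≤ r → 1 - ProbabilityTheory.cdf μ b ≤
      (1 - ProbabilityTheory.cdf μ a) * Real.exp (-c * (b - a)))
    {u : ℝ → ENNReal} (hu : Measurable u) :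
    ∫⁻ s in Icc 0 r, ENNReal.ofReal (c * (1 - ProbabilityTheory.cdf μ s)) * u s ≤
      ∫⁻ s in Icc 0 r, u s ∂μ := by
  set T : ℝ → ℝ := fun x => 1 - ProbabilityTheory.cdf μ x
  have hTc : Continuous T := continuous_const.sub continuous_cdf
  have hT0 : ∀ x, 0 ≤ T x := fun x => sub_nonneg.2 (ProbabilityTheory.cdf_le_one μ x)
  have hwm : Measurable fun s => ENNReal.ofReal (c * T s) := by fun_prop
  have hle : (volume.restrict (Icc 0 r)).withDensity (fun s => ENNReal.ofReal (c * T s)) ≤ μ := by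
    conv_rhs => rw [← ProbabilityTheory.measure_cdf μ]
    refine StieltjesFunction.le_measure_of_Ioc_le _ fun a b => ?_
    rw [withDensity_apply _ measurableSet_Ioc, Measure.restrict_restrict measurableSet_Ioc]
    set a' := max a 0
    set b' := min b r
    have hsub : (Ioc a b ∩ Icc 0 r : Set ℝ) ⊆ Icc a' b' := fun x hx =>
      ⟨max_le hx.1.1.le hx.2.1, le_min hx.1.2 hx.2.2⟩
    refine (lintegral_mono_set hsub).trans ?_
    rcases lt_or_ge b' a' with hlt | hle
    · simp [Icc_eq_empty_of_lt hlt]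
    · rw [setLIntegral_congr Ioc_ae_eq_Icc.symm, ← ofReal_integral_eq_lintegral_ofReal,
        ← intervalIntegral.integral_of_le hle]
      · apply ENNReal.ofReal_le_ofReal
        refine (integral_le_of_le_mul_exp hTc h (le_max_right _ _) hle (min_le_right _ _)).trans ?_
        have h1 := ProbabilityTheory.monotone_cdf μ (le_max_left a 0)
        have h2 := ProbabilityTheory.monotone_cdf μ (min_le_left b r)
        simp only [T]
        linarith
      · exact (hTc.const_mul c).integrableOn_Ioc
      · exact ae_of_all _ fun x => mul_nonneg hc (hT0 x)
  calc ∫⁻ s in Icc 0 r, ENNReal.ofReal (c * T s) * u s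
      = ∫⁻ s in Icc 0 r, ENNReal.ofReal (c * T s) * u s ∂(volume.restrict (Icc 0 r)) := by
        rw [Measure.restrict_restrict measurableSet_Icc, inter_self]
    _ = ∫⁻ s in Icc 0 r, u s ∂((volume.restrict (Icc 0 r)).withDensity
          (fun s => ENNReal.ofReal (c * T s))) := by
        rw [setLIntegral_withDensity_eq_setLIntegral_mul _ hwm hu measurableSet_Icc]
        rfl
    _ ≤ _ := lintegral_mono' (Measure.restrict_mono le_rfl hle) le_rfl

/-- The `L¹` Hardy inequality on one half of a segment. -/
lemma hardy_Icc {μ : Measure ℝ} [IsProbabilityMeasure μ] [NullSingletonClass μ] {r c : ℝ} (hc : 0 ≤ c)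
    (h : ∀ a b, 0 ≤ a → a ≤ b → b ≤ r → 1 - ProbabilityTheory.cdf μ b ≤
      (1 - ProbabilityTheory.cdf μ a) * Real.exp (-c * (b - a)))
    {G : ℝ → ℝ} (hG : Differentiable ℝ G) {K : ℝ} (hK : ∀ x, ‖deriv G x‖ ≤ K) (hG0 : G 0 = 0) :
    ENNReal.ofReal c * ∫⁻ x in Icc 0 r, ‖G x‖ₑ ∂μ ≤ ∫⁻ x in Icc 0 r, ‖deriv G x‖ₑ ∂μ := by
  have hum : Measurable fun s => ‖deriv G s‖ₑ := (measurable_deriv G).enorm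
  -- `|G(x)| ≤ ∫₀ˣ |G'|`, written with an indicator in order to exchange the integrals; the inner
  -- integral is then at most the tail at `s`.
  have hpt : ∀ x ∈ Icc (0 : ℝ) r, ‖G x‖ₑ ≤ ∫⁻ s in Ioc 0 r, (Ici s).indicator 1 x * ‖deriv G s‖ₑ := by
    intro x hx
    have hi : IntervalIntegrable (deriv G) volume 0 x := by
      refine (intervalIntegrable_const (c := K)).mono_fun
        (measurable_deriv G).aestronglyMeasurable (ae_of_all _ fun s => ?_)
      exact (hK s).trans (le_abs_self K)
    have := intervalIntegral.integral_deriv_eq_sub (fun y _ => hG y) hi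
    rw [hG0, sub_zero, intervalIntegral.integral_of_le hx.1] at this
    rw [← this]
    refine (enorm_integral_le_lintegral_enorm _).trans ?_
    have hind : ∀ s, (Ici s).indicator (1 : ℝ → ENNReal) x * ‖deriv G s‖ₑ =
        (Iic x).indicator (fun s => ‖deriv G s‖ₑ) s := fun s => by
      by_cases hs : s ≤ x <;> simp [indicator, hs]
    simp only [hind]
    rw [lintegral_indicator measurableSet_Iic, Measure.restrict_restrict measurableSet_Iic]
    exact lintegral_mono_set fun s hs => ⟨hs.2, hs.1, hs.2.trans hx.2⟩
  have hind_meas : Measurable fun p : ℝ × ℝ => (Ici p.2).indicator (1 : ℝ → ENNReal) p.1 := by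
    have : (fun p : ℝ × ℝ => (Ici p.2).indicator (1 : ℝ → ENNReal) p.1) =
        {p : ℝ × ℝ | p.2 ≤ p.1}.indicator 1 := by
      ext p
      simp [indicator]
    rw [this]
    exact measurable_one.indicator (measurableSet_le measurable_snd measurable_fst)
  calc ENNReal.ofReal c * ∫⁻ x in Icc 0 r, ‖G x‖ₑ ∂μ
      ≤ ENNReal.ofReal c * ∫⁻ x in Icc 0 r, (∫⁻ s in Ioc 0 r,
          (Ici s).indicator 1 x * ‖deriv G s‖ₑ) ∂μ := by
        gcongr 1
        exact setLIntegral_mono' measurableSet_Icc hpt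
    _ = ENNReal.ofReal c * ∫⁻ s in Ioc 0 r, ∫⁻ x in Icc 0 r,
          (Ici s).indicator 1 x * ‖deriv G s‖ₑ ∂μ := by
        rw [lintegral_lintegral_swap]
        exact (hind_meas.mul (hum.comp measurable_snd)).aemeasurable
    _ ≤ ENNReal.ofReal c * ∫⁻ s in Ioc 0 r,
          ENNReal.ofReal (1 - ProbabilityTheory.cdf μ s) * ‖deriv G s‖ₑ := by
        gcongr with s
        rw [lintegral_mul_const _ (measurable_one.indicator measurableSet_Ici)]
        gcongr
        refine (setLIntegral_le_lintegral _ _).trans ?_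
        rw [lintegral_indicator_one measurableSet_Ici, ProbabilityTheory.cdf_eq_real,
          ← probReal_compl_eq_one_sub measurableSet_Iic, compl_Iic, ofReal_measureReal,
          measure_congr Ioi_ae_eq_Ici]
    _ = ∫⁻ s in Icc 0 r, ENNReal.ofReal (c * (1 - ProbabilityTheory.cdf μ s)) * ‖deriv G s‖ₑ := by
        rw [setLIntegral_congr Ioc_ae_eq_Icc, ← lintegral_const_mul']
        · simp only [ENNReal.ofReal_mul hc, mul_assoc]
        · exact ENNReal.ofReal_ne_top
    _ ≤ _ := setLIntegral_density_le hc h hum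

/-- The `L¹` Hardy inequality for a symmetric measure conditioned to a centered segment. -/
lemma hardyInequality_cond {μ : Measure ℝ} [IsProbabilityMeasure μ] [NullSingletonClass μ]
    (hsymm : μ.map (fun x : ℝ => -x) = μ) {r c : ℝ} (hc : 0 ≤ c)
    (h : ∀ a b, 0 ≤ a → a ≤ b → b ≤ r → 1 - ProbabilityTheory.cdf μ b ≤
      (1 - ProbabilityTheory.cdf μ a) * Real.exp (-c * (b - a))) :
    HardyInequality (ProbabilityTheory.cond μ (Icc (-r) r)) c := by
  rintro G hG ⟨K, hK⟩ hG0
  have hneg : ∀ {u : ℝ → ENNReal}, Measurable u →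
      ∫⁻ x in Icc (-r) 0, u x ∂μ = ∫⁻ x in Icc 0 r, u (-x) ∂μ := fun {u} hu => by
    conv_lhs => rw [← hsymm]
    rw [setLIntegral_map measurableSet_Icc hu measurable_neg]
    congr 2
    ext x
    simp [and_comm]
  have hd : ∀ x, deriv (fun x => G (-x)) x = -deriv G (-x) := fun x => deriv_comp_neg G x
  have hpos := hardy_Icc hc h hG hK hG0
  have hneg' := hardy_Icc hc h (G := fun x => G (-x)) (hG.comp differentiable_neg)
    (K := K) (fun x => by rw [hd, norm_neg]; exact hK _) (by simpa using hG0)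
  simp only [hd, enorm_neg] at hneg'
  rw [← hneg hG.continuous.measurable.enorm, ← hneg (measurable_deriv G).enorm] at hneg'
  have hsplit : ∀ u : ℝ → ENNReal, ∫⁻ x in Icc (-r) r, u x ∂μ ≤
      ∫⁻ x in Icc (-r) 0, u x ∂μ + ∫⁻ x in Icc 0 r, u x ∂μ := fun u => by
    refine (lintegral_mono_set fun x hx => ?_).trans (lintegral_union_le u _ _)
    rcases le_total x 0 with h0 | h0
    · exact Or.inl ⟨hx.1, h0⟩
    · exact Or.inr ⟨h0, hx.2⟩
  have hsplit' : ∀ u : ℝ → ENNReal, ∫⁻ x in Icc (-r) 0, u x ∂μ + ∫⁻ x in Icc 0 r, u x ∂μ ≤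
      ∫⁻ x in Icc (-r) r, u x ∂μ := fun u => by
    -- The two halves share the point `0`, which carries no mass and is dropped to make them
    -- disjoint.
    rw [setLIntegral_congr Ioc_ae_eq_Icc.symm (s := Icc 0 r), ← lintegral_union measurableSet_Ioc]
    · refine lintegral_mono_set ?_
      rintro x (hx | hx)
      · exact ⟨hx.1, by linarith [hx.1, hx.2]⟩
      · exact ⟨by linarith [hx.1, hx.2], hx.2⟩
    · exact Set.disjoint_left.2 fun x hx hx' => not_lt.2 hx.2 hx'.1
  simp only [ProbabilityTheory.cond, lintegral_smul_measure, smul_eq_mul]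
  rw [mul_left_comm]
  gcongr
  calc _ ≤ ENNReal.ofReal c * (∫⁻ x in Icc (-r) 0, ‖G x‖ₑ ∂μ + ∫⁻ x in Icc 0 r, ‖G x‖ₑ ∂μ) := by
        gcongr; exact hsplit _
    _ ≤ _ := by
        rw [mul_add]
        exact (add_le_add hneg' hpos).trans (hsplit' _)

/-! ### Enlargements of sets in the product space. -/

lemma productMeasure_real_apply (ν : Measure ℝ) [SigmaFinite ν] (n : ℕ)
    {S : Set (EuclideanSpace ℝ (Fin n))} (hS : MeasurableSet S) :
    (productMeasure ν n).real S = (Measure.pi fun _ : Fin n => ν).real (WithLp.toLp 2 ⁻¹' S) :=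
  map_measureReal_apply (WithLp.measurable_toLp 2 _) hS

lemma sum_sq_apply_single_le {n : ℕ} (ℓ : EuclideanSpace ℝ (Fin n) →L[ℝ] ℝ) :
    ∑ i, (ℓ (EuclideanSpace.single i 1)) ^ 2 ≤ ‖ℓ‖ ^ 2 := by
  set v := (InnerProductSpace.toDual ℝ (EuclideanSpace ℝ (Fin n))).symm ℓ with hv
  have h1 : ∀ i, ℓ (EuclideanSpace.single i 1) = v i := fun i => by
    rw [← InnerProductSpace.toDual_symm_apply (𝕜 := ℝ) (y := ℓ)]
    simp [← hv, EuclideanSpace.inner_single_right]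
  have h2 : ‖ℓ‖ = ‖v‖ := by rw [hv, LinearIsometryEquiv.norm_map]
  rw [h2, EuclideanSpace.norm_sq_eq]
  simp [h1]

/-- Bobkov's functional inequality applied to a smooth cutoff of a set. -/
lemma BobkovInequality.mul_le_enlargement {ν : Measure ℝ} [IsProbabilityMeasure ν] {a : ℝ}
    (ha : 0 ≤ a) (hν : BobkovInequality ν a) {n : ℕ} {A : Set (EuclideanSpace ℝ (Fin n))}
    (hA : MeasurableSet A) (hne : A.Nonempty) {h δ : ℝ} (hδ : 0 < δ) (hh : 2 * δ < h) :
    (productMeasure ν n).real A * (1 - (productMeasure ν n).real A -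
        (productMeasure ν n).real (Metric.cthickening h A \ A)) ≤
      (productMeasure ν n).real (Metric.cthickening h A \ A) * (1 / 4 + a * (1 / (h - 2 * δ))) := by
  obtain ⟨f, hf, hfL, hf01, hfA, hfc⟩ := exists_smooth_cutoff hne hδ hh
  have hS : MeasurableSet (Metric.cthickening h A \ A) :=
    Metric.isClosed_cthickening.measurableSet.diff hA
  rw [productMeasure_real_apply ν n hA, productMeasure_real_apply ν n hS]
  set π : Measure (Fin n → ℝ) := Measure.pi fun _ => ν
  set e : (Fin n → ℝ) → EuclideanSpace ℝ (Fin n) := WithLp.toLp 2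
  have he : Measurable e := WithLp.measurable_toLp 2 _
  set L : ℝ := 1 / (h - 2 * δ) with hL
  have hL0 : 0 ≤ L := one_div_nonneg.2 (by linarith)
  let E : (Fin n → ℝ) →L[ℝ] EuclideanSpace ℝ (Fin n) :=
    (EuclideanSpace.equiv (Fin n) ℝ).symm.toContinuousLinearMap
  have hd : ∀ x, HasFDerivAt (fun x => f (e x)) ((fderiv ℝ f (e x)).comp E) x := fun x =>
    (hf (e x)).hasFDerivAt.comp x E.hasFDerivAt
  have key := hν.pi n (fun x => f (e x)) (fun x => (hd x).differentiableAt)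
    ⟨L * ‖E‖, fun x => by
      rw [(hd x).fderiv]
      exact (ContinuousLinearMap.opNorm_comp_le _ _).trans (by gcongr; exact hfL _)⟩
    (fun x => hf01 _)
  have hEs : ∀ i, E (Pi.single i 1) = EuclideanSpace.single i 1 := fun i => rfl
  simp only [(hd _).fderiv, ContinuousLinearMap.comp_apply, hEs] at key
  have hAm : MeasurableSet (e ⁻¹' A) := he hA
  have hSm : MeasurableSet (e ⁻¹' (Metric.cthickening h A \ A)) := he hS
  have hfI : Integrable (fun x => f (e x)) π :=
    integrable_of_mem_Icc (hf.continuous.measurable.comp he) fun x => hf01 _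
  have hlow : π.real (e ⁻¹' A) ≤ ∫ x, f (e x) ∂π := by
    rw [← integral_indicator_one hAm]
    refine integral_mono ((integrable_const 1).indicator hAm) hfI fun x => ?_
    by_cases hx : e x ∈ A
    · simp [indicator, hx, hfA]
    · simpa [indicator, hx] using (hf01 (e x)).1
  have hupp : ∫ x, f (e x) ∂π ≤
      π.real (e ⁻¹' A) + π.real (e ⁻¹' (Metric.cthickening h A \ A)) := by
    rw [← integral_indicator_one hAm, ← integral_indicator_one hSm,
      ← integral_add ((integrable_const 1).indicator hAm) ((integrable_const 1).indicator hSm)]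
    refine integral_mono hfI (((integrable_const 1).indicator hAm).add
      ((integrable_const 1).indicator hSm)) fun x => ?_
    by_cases hx : e x ∈ A
    · simp [indicator, hx, hfA]
    · by_cases hx' : e x ∈ Metric.cthickening h A
      · simpa [indicator, hx, hx'] using (hf01 (e x)).2
      · simp [indicator, hx, hx', hfc]
  have hright : ∫ x, √((f (e x) * (1 - f (e x))) ^ 2 +
      ∑ i, (a * fderiv ℝ f (e x) (EuclideanSpace.single i 1)) ^ 2) ∂π ≤
      π.real (e ⁻¹' (Metric.cthickening h A \ A)) * (1 / 4 + a * L) := by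
    rw [← smul_eq_mul, ← integral_indicator_const _ hSm]
    refine integral_mono_of_nonneg (ae_of_all _ fun x => Real.sqrt_nonneg _)
      ((integrable_const _).indicator hSm) (ae_of_all _ fun x => ?_)
    -- Where the cutoff attains an extreme value its gradient vanishes, even on the boundary of `A`;
    -- hence the integrand lives on the enlargement minus `A`.
    have hzero : f (e x) = 1 ∨ f (e x) = 0 → √((f (e x) * (1 - f (e x))) ^ 2 +
        ∑ i, (a * fderiv ℝ f (e x) (EuclideanSpace.single i 1)) ^ 2) = 0 := by
      rintro (h1 | h0)
      · have : IsLocalMax f (e x) := Eventually.of_forall fun y => h1 ▸ (hf01 y).2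
        simp [this.fderiv_eq_zero, h1]
      · have : IsLocalMin f (e x) := Eventually.of_forall fun y => h0 ▸ (hf01 y).1
        simp [this.fderiv_eq_zero, h0]
    by_cases hx : e x ∈ A
    · simp [indicator, hx, hzero (Or.inl (hfA _ hx))]
    · by_cases hx' : e x ∈ Metric.cthickening h A
      · have hI := mul_one_sub_mem_Icc (hf01 (e x))
        have hsum : ∑ i, (a * fderiv ℝ f (e x) (EuclideanSpace.single i 1)) ^ 2 ≤ (a * L) ^ 2 := by
          simp only [mul_pow]
          rw [← Finset.mul_sum]
          gcongr
          exact (sum_sq_apply_single_le _).trans (by gcongr; exact hfL _)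
        have : √((f (e x) * (1 - f (e x))) ^ 2 +
            ∑ i, (a * fderiv ℝ f (e x) (EuclideanSpace.single i 1)) ^ 2) ≤ 1 / 4 + a * L := by
          have haL := mul_nonneg ha hL0
          refine Real.sqrt_le_iff.2 ⟨by positivity, ?_⟩
          nlinarith [hI.1, hI.2]
        simpa [indicator, hx, hx'] using this
      · simp [indicator, hx, hx', hzero (Or.inr (hfc _ hx'))]
  refine le_trans ?_ (key.trans hright)
  have hle1 := (integral_mem_Icc (ν := π) (hf.continuous.measurable.comp he) fun x => hf01 (e x)).2
  simp only [Function.comp_def] at hle1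
  have hP : 0 ≤ π.real (e ⁻¹' A) := measureReal_nonneg
  nlinarith

lemma pi_cond {n : ℕ} (μ : Measure ℝ) [IsProbabilityMeasure μ] {K : Set ℝ} (hK : MeasurableSet K)
    (hK0 : μ K ≠ 0) :
    (Measure.pi fun _ : Fin n => ProbabilityTheory.cond μ K) =
      ProbabilityTheory.cond (Measure.pi fun _ : Fin n => μ) (univ.pi fun _ => K) := by
  have := ProbabilityTheory.cond_isProbabilityMeasure hK0
  refine Measure.pi_eq fun s hs => ?_
  rw [ProbabilityTheory.cond_apply (MeasurableSet.univ_pi fun _ => hK), ← pi_inter_distrib,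
    Measure.pi_pi, Measure.pi_pi]
  simp only [ProbabilityTheory.cond_apply hK]
  rw [Finset.prod_mul_distrib, Finset.prod_const, Finset.prod_const, ENNReal.inv_pow]

/-! ### Quantiles and the isoperimetric function. -/

lemma exists_cdf_quantile {μ : Measure ℝ} [IsProbabilityMeasure μ] [NullSingletonClass μ] {t : ℝ}
    (ht0 : 0 < t) (ht1 : t < 1) :
    ProbabilityTheory.cdf μ (sInf {x : ℝ | t ≤ ProbabilityTheory.cdf μ x}) = t := by
  have hc := continuous_cdf (μ := μ)
  obtain ⟨x₀, hx₀⟩ :=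
    ((ProbabilityTheory.tendsto_cdf_atBot μ).eventually_lt_const ht0).exists
  obtain ⟨x₁, hx₁⟩ :=
    ((ProbabilityTheory.tendsto_cdf_atTop μ).eventually_const_lt ht1).exists
  obtain ⟨x, hx⟩ := mem_range_of_exists_le_of_exists_ge hc ⟨x₀, hx₀.le⟩ ⟨x₁, hx₁.le⟩
  have hbdd : BddBelow {x : ℝ | t ≤ ProbabilityTheory.cdf μ x} := ⟨x₀, fun y hy => by
    by_contra hlt
    exact absurd (hy.trans (ProbabilityTheory.monotone_cdf μ (not_le.1 hlt).le)) (not_le.2 hx₀)⟩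
  refine le_antisymm ?_ ?_
  · exact (ProbabilityTheory.monotone_cdf μ (csInf_le hbdd hx.ge)).trans hx.le
  · exact (isClosed_le continuous_const hc).csInf_mem ⟨x, hx.ge⟩ hbdd

lemma hasDerivWithinAt_tail {μ : Measure ℝ} [IsProbabilityMeasure μ] [NullSingletonClass μ]
    (hsymm : μ.map (fun x : ℝ => -x) = μ) {r d : ℝ} {s s' : Set ℝ}
    (hs : MapsTo (fun x : ℝ => -x) s' s)
    (h : HasDerivWithinAt (ProbabilityTheory.cdf μ) d s (-r)) :
    HasDerivWithinAt (fun x => 1 - ProbabilityTheory.cdf μ x) (-d) s' r := by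
  have h1 : HasDerivWithinAt (fun x : ℝ => -x) (-1) s' r := (hasDerivAt_neg r).hasDerivWithinAt
  have := h.comp r h1 hs
  rw [mul_neg_one] at this
  exact this.congr (fun x _ => (cdf_neg_eq hsymm x).symm) (cdf_neg_eq hsymm r).symm

/-- A positive value of the isoperimetric function controls the decay of the tail up to the
corresponding quantile. -/
lemma exists_tail_le_mul_exp {μ : Measure ℝ} [IsProbabilityMeasure μ] [NullSingletonClass μ]
    (hsymm : μ.map (fun x : ℝ => -x) = μ)
    (hconv : ConvexOn ℝ (Ici (0 : ℝ)) fun r : ℝ => Real.log (1 - ProbabilityTheory.cdf μ r))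
    {t : ℝ} (ht0 : 0 < t) (ht : t < 1 / 2) (hJ : 0 < isoFunction μ t) :
    ∃ r : ℝ, μ.real (Icc (-r) r) = 1 - 2 * t ∧
      ∀ a b, 0 ≤ a → a ≤ b → b ≤ r → 1 - ProbabilityTheory.cdf μ b ≤
        (1 - ProbabilityTheory.cdf μ a) * Real.exp (-(isoFunction μ t / t) * (b - a)) := by
  have hmono := ProbabilityTheory.monotone_cdf μ
  set q := sInf {x : ℝ | t ≤ ProbabilityTheory.cdf μ x} with hq
  have hFq : ProbabilityTheory.cdf μ q = t := exists_cdf_quantile ht0 (by linarith)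
  have hF0 : ProbabilityTheory.cdf μ 0 = 1 / 2 := by
    have := cdf_neg_eq hsymm 0
    rw [neg_zero] at this
    linarith
  have hq0 : q < 0 := by
    by_contra hcon
    have := hmono (not_lt.1 hcon)
    linarith
  have hTr : 1 - ProbabilityTheory.cdf μ (-q) = t := by rw [cdf_neg_eq hsymm]; linarith
  refine ⟨-q, ?_, fun a b ha hab hb => ?_⟩
  · rw [neg_neg, measureReal_def, measure_congr Ioc_ae_eq_Icc.symm, ← ProbabilityTheory.measure_cdf μ,
      StieltjesFunction.measure_Ioc, ENNReal.toReal_ofReal]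
    · linarith
    · linarith
  · refine tail_le_mul_exp (T := fun x => 1 - ProbabilityTheory.cdf μ x) (r := -q) hconv
      (by linarith) (fun x hx => ?_) ?_ ha hab hb
    · have := hmono hx
      linarith
    · have hJe : isoFunction μ t = max (derivWithin (ProbabilityTheory.cdf μ) (Iio q) q)
          (derivWithin (ProbabilityTheory.cdf μ) (Ioi q) q) := by
        rw [isoFunction, if_pos ⟨ht0, by linarith⟩]
      simp only [hTr]
      rw [div_mul_cancel₀ _ ht0.ne']
      -- Since `J_μ(t) > 0`, the one-sided derivative attaining the maximum is not the default value
      -- `0`, so it exists.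
      have hderiv : ∀ s, isoFunction μ t = derivWithin (ProbabilityTheory.cdf μ) s q →
          HasDerivWithinAt (ProbabilityTheory.cdf μ) (isoFunction μ t) s (- -q) := fun s hs => by
        rw [neg_neg, hs]
        refine (not_not.1 fun hn => hJ.ne' ?_ :
          DifferentiableWithinAt ℝ (ProbabilityTheory.cdf μ) s q).hasDerivWithinAt
        rw [hs, derivWithin_zero_of_not_differentiableWithinAt hn]
      rcases max_choice (derivWithin (ProbabilityTheory.cdf μ) (Iio q) q)
        (derivWithin (ProbabilityTheory.cdf μ) (Ioi q) q) with h | h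
      -- The reflection `x ↦ -x` exchanges the sides: a left derivative of the distribution function
      -- at `q` is a right derivative of the tail at `-q`.
      · refine Or.inr (hasDerivWithinAt_tail hsymm (s := Iio q) (fun x hx => ?_)
          (hderiv _ (hJe.trans h)))
        simp only [mem_Ioi, mem_Iio] at hx ⊢
        linarith
      · refine Or.inl (hasDerivWithinAt_tail hsymm (s := Ioi q) (fun x hx => ?_)
          (hderiv _ (hJe.trans h)))
        simp only [mem_Ioi, mem_Iio] at hx ⊢
        linarith

/-! ### Return from the conditioned product to `μⁿ`, and the constants. -/

lemma productMeasure_cond_real {μ : Measure ℝ} [IsProbabilityMeasure μ] {K : Set ℝ}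
    (hK : MeasurableSet K) (hK0 : μ K ≠ 0) (n : ℕ) {S : Set (EuclideanSpace ℝ (Fin n))}
    (hS : MeasurableSet S) :
    (productMeasure (ProbabilityTheory.cond μ K) n).real S =
      (μ.real K ^ n)⁻¹ * (Measure.pi fun _ : Fin n => μ).real
        ((univ.pi fun _ => K) ∩ WithLp.toLp 2 ⁻¹' S) := by
  have := ProbabilityTheory.cond_isProbabilityMeasure hK0
  rw [productMeasure_real_apply _ n hS, pi_cond μ hK hK0, measureReal_def,
    ProbabilityTheory.cond_apply (MeasurableSet.univ_pi fun _ => hK), Measure.pi_pi,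
    ENNReal.toReal_mul]
  simp [measureReal_def]

lemma kappa₁_bounds : 4.88 ≤ kappa₁ ∧ 0 < kappa₁ := by
  have : (2.44 : ℝ) ≤ √6 := Real.le_sqrt_of_sq_le (by norm_num)
  constructor <;> · rw [kappa₁]; linarith

lemma kappa₂_eq : kappa₂ = 2 * (1 + kappa₁) := rfl

/-- Here `p` is the mass of the cube, `x` that of `A` in it and `D` that of the enlargement minus
`A` in it. Moving `x D ≤ p D` to the right turns `1 / 4` into `5 / 4`; then `5/4 · 4/25 + 80/19 ≤
0.9149 · 4.88` leaves just enough room. -/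
lemma boundary_bound {h c p x D m κ : ℝ} (hh : 0 < h) (hc : 0 < c) (hp : 0 < p)
    (hm : 0 < m) (hx1 : m * 0.9149 ≤ x) (hx2 : m * 0.9149 ≤ p - x) (hD0 : 0 ≤ D)
    (hhc : h * c ≤ 4 / 25) (hκ : 4.88 ≤ κ)
    (key : p⁻¹ * x * (1 - p⁻¹ * x - p⁻¹ * D) ≤ p⁻¹ * D * (1 / 4 + 4 / c * (1 / (19 / 20 * h)))) :
    m * h * c ≤ 2 * D * κ := by
  have hx0 : 0 < x := by linarith
  have hy0 : 0 < p - x := by linarith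
  have hm1 : m * 0.9149 * p ≤ 2 * (x * (p - x)) := by
    rcases le_total x (p - x) with hle | hle
    · have := mul_le_mul_of_nonneg_right hx1 hy0.le
      have : m * 0.9149 * p ≤ m * 0.9149 * (2 * (p - x)) := by gcongr; linarith
      linarith
    · have := mul_le_mul_of_nonneg_left hx2 hx0.le
      have : m * 0.9149 * p ≤ m * 0.9149 * (2 * x) := by gcongr; linarith
      linarith
  have hhc0 : 0 < h * c := by positivity
  have key2 : x * (p - x) * (h * c) ≤ D * p * (5 / 4 * (h * c) + 80 / 19) := by
    have h1 : p⁻¹ * x * (1 - p⁻¹ * x - p⁻¹ * D) = x * (p - x - D) / p ^ 2 := by field_simp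
    have h2 : p⁻¹ * D * (1 / 4 + 4 / c * (1 / (19 / 20 * h))) =
        D * p * (1 / 4 * (h * c) + 80 / 19) / (h * c) / p ^ 2 := by field_simp; ring
    rw [h1, h2, div_le_div_iff_of_pos_right (by positivity), le_div_iff₀ hhc0] at key
    have : x * (D * (h * c)) ≤ p * (D * (h * c)) := by gcongr; linarith
    linarith
  have key3 : m * 0.9149 * (h * c) ≤ 2 * D * (5 / 4 * (h * c) + 80 / 19) := by
    have := mul_le_mul_of_nonneg_right hm1 hhc0.le
    have : (m * 0.9149 * (h * c)) * p ≤ (2 * D * (5 / 4 * (h * c) + 80 / 19)) * p := by linarith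
    exact le_of_mul_le_mul_right this hp
  have key4 : 5 / 4 * (h * c) + 80 / 19 ≤ 0.9149 * κ := by
    have : (80 / 19 : ℝ) ≤ 4.2106 := by norm_num
    linarith
  have key5 : 2 * D * (5 / 4 * (h * c) + 80 / 19) ≤ 2 * D * (0.9149 * κ) := by gcongr
  linarith

/-- The isoperimetric inequality for the enlargements of small radius. -/
lemma mul_le_real_enlargement {μ : Measure ℝ} [IsProbabilityMeasure μ] {K : Set ℝ}
    (hK : MeasurableSet K) {c t : ℝ} (hc : 0 < c) (ht0 : 0 < t)
    (hKt : μ.real K = 1 - 2 * t) (hH : HardyInequality (ProbabilityTheory.cond μ K) c)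
    {n : ℕ} {A : Set (EuclideanSpace ℝ (Fin n))} (hA : MeasurableSet A) {m : ℝ} (hm : 0 < m)
    (hmA : m ≤ (productMeasure μ n).real A) (hmA' : m ≤ 1 - (productMeasure μ n).real A)
    (hm2 : 2 * n * t * kappa₂ ≤ m) (ht2 : 2 * t < 1) {h : ℝ} (hh : 0 < h) (hhc : h * c ≤ 4 / 25) :
    c * m / (2 * kappa₁) * h ≤ (productMeasure μ n).real (Metric.cthickening h A \ A) := by
  obtain ⟨hκ, hκ0⟩ := kappa₁_bounds
  have hK0 : μ K ≠ 0 := fun h0 => by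
    rw [measureReal_def, h0, ENNReal.toReal_zero] at hKt
    linarith
  have hP := ProbabilityTheory.cond_isProbabilityMeasure hK0
  have hne : A.Nonempty := by
    rw [nonempty_iff_ne_empty]
    rintro rfl
    rw [measureReal_empty] at hmA
    linarith
  have hS : MeasurableSet (Metric.cthickening h A \ A) :=
    Metric.isClosed_cthickening.measurableSet.diff hA
  -- With `δ = h / 40` the gradient bound is `1 / (19h / 20)`, whence `80 / 19 = 4 · 20 / 19`.
  have key := (hH.bobkovInequality hc).mul_le_enlargement (by positivity) hA hne (h := h)
    (δ := h / 40) (by positivity) (by linarith)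
  rw [productMeasure_cond_real hK hK0 n hA, productMeasure_cond_real hK hK0 n hS] at key
  rw [productMeasure_real_apply μ n hA] at hmA hmA'
  rw [productMeasure_real_apply μ n hS]
  set π : Measure (Fin n → ℝ) := Measure.pi fun _ => μ
  set Q : Set (Fin n → ℝ) := univ.pi fun _ => K
  set e : (Fin n → ℝ) → EuclideanSpace ℝ (Fin n) := WithLp.toLp 2
  have he : Measurable e := WithLp.measurable_toLp 2 _
  have hQm : MeasurableSet Q := MeasurableSet.univ_pi fun _ => hK
  have hAm : MeasurableSet (e ⁻¹' A) := he hA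
  have hQ : π.real Q = μ.real K ^ n := by
    simp [π, Q, measureReal_def, Measure.pi_pi]
  -- Bernoulli's inequality: the cube misses at most `2nt`.
  have hQ1 : 1 - 2 * n * t ≤ μ.real K ^ n := by
    have := one_add_mul_le_pow (a := -2 * t) (by linarith) n
    rw [hKt]
    calc 1 - 2 * n * t = 1 + n * (-2 * t) := by ring
      _ ≤ _ := this
      _ = _ := by congr 1; ring
  set p := μ.real K ^ n
  have hp : 0 < p := by
    have : 0 < μ.real K := by linarith
    positivity
  set x := π.real (Q ∩ e ⁻¹' A)
  set D := π.real (Q ∩ e ⁻¹' (Metric.cthickening h A \ A))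
  have hD : D ≤ π.real (e ⁻¹' (Metric.cthickening h A \ A)) := measureReal_mono inter_subset_right
  have hD0 : 0 ≤ D := measureReal_nonneg
  refine le_trans ?_ hD
  have hsplitQ : x + π.real (Q \ e ⁻¹' A) = p := by
    rw [← hQ]; exact measureReal_inter_add_sdiff hAm
  have hQc : π.real Qᶜ = 1 - p := by rw [probReal_compl_eq_one_sub hQm, hQ]
  have hAx : π.real (e ⁻¹' A) ≤ x + (1 - p) := by
    rw [← hQc]
    refine (measureReal_mono (fun y hy => ?_)).trans (measureReal_union_le _ _)
    by_cases hyQ : y ∈ Q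
    · exact Or.inl ⟨hyQ, hy⟩
    · exact Or.inr hyQ
  have hxA : x ≤ π.real (e ⁻¹' A) := measureReal_mono inter_subset_right
  have hloss : 1 - p ≤ m / kappa₂ := by
    rw [le_div_iff₀ (by rw [kappa₂_eq]; positivity)]
    have : 0 < kappa₂ := by rw [kappa₂_eq]; positivity
    nlinarith
  -- `κ₂ = 2(1 + κ₁) ≥ 11.76` and `1 / 11.76 < 0.0851 = 1 - 0.9149`.
  have hm' : m / kappa₂ ≤ m * 0.0851 := by
    rw [div_le_iff₀ (by rw [kappa₂_eq]; positivity), kappa₂_eq]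
    nlinarith
  have hx1 : m * 0.9149 ≤ x := by linarith
  have hx2 : m * 0.9149 ≤ p - x := by linarith
  have hfin := boundary_bound hh hc hp hm hx1 hx2 hD0 hhc hκ
    (by rwa [show h - 2 * (h / 40) = 19 / 20 * h by ring] at key)
  rw [div_mul_eq_mul_div, div_le_iff₀ (by positivity)]
  linarith

theorem mainTheorem2 (μ : Measure ℝ) [IsProbabilityMeasure μ]
    (hsymm : μ.map (fun x : ℝ => -x) = μ)
    (hac : μ ≪ volume)
    (hconv : ConvexOn ℝ (Ici (0 : ℝ)) fun r : ℝ => Real.log (1 - ProbabilityTheory.cdf μ r))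
    (n : ℕ) (A : Set (EuclideanSpace ℝ (Fin n))) (hA : MeasurableSet A) :
    ENNReal.ofReal (n * kappa₂ / kappa₁ *
        isoFunction μ (min ((productMeasure μ n).real A) (1 - (productMeasure μ n).real A) /
          (2 * n * kappa₂))) ≤
      boundaryMeasure (productMeasure μ n) A := by
  have : NullSingletonClass μ := ⟨fun x => hac (measure_singleton x)⟩
  obtain ⟨hκ, hκ0⟩ := kappa₁_bounds
  have hκ2 : 0 < kappa₂ := by rw [kappa₂_eq]; positivity
  have hprob : IsProbabilityMeasure (productMeasure μ n) :=
    Measure.isProbabilityMeasure_map (WithLp.measurable_toLp 2 _).aemeasurable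
  set M := (productMeasure μ n).real A
  set m := min M (1 - M) with hmdef
  have hm0 : 0 ≤ m := le_min measureReal_nonneg (sub_nonneg.2 measureReal_le_one)
  have hm1 : m ≤ 1 / 2 := by
    rcases le_total M (1 / 2) with h | h
    · exact (min_le_left _ _).trans h
    · exact (min_le_right _ _).trans (by linarith)
  set t := m / (2 * n * kappa₂) with ht
  rcases le_or_gt (isoFunction μ t) 0 with hJ | hJ
  · rw [ENNReal.ofReal_of_nonpos (mul_nonpos_of_nonneg_of_nonpos (by positivity) hJ)]
    exact zero_le
  have ht0 : 0 < t := by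
    by_contra hcon
    rw [isoFunction, if_neg fun h => hcon h.1] at hJ
    exact lt_irrefl _ hJ
  have hn : 0 < n := by
    rcases Nat.eq_zero_or_pos n with rfl | hn
    -- For `n = 0` the division by zero gives `t = 0`.
    · simp [ht] at ht0
    · exact hn
  have hn1 : (1 : ℝ) ≤ n := by exact_mod_cast hn
  have hden : 0 < 2 * n * kappa₂ := by positivity
  have hmt : m = t * (2 * n * kappa₂) := by rw [ht, div_mul_cancel₀ _ hden.ne']
  have hmpos : 0 < m := hmt ▸ mul_pos ht0 hden
  have ht1 : t < 1 / 2 := by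
    rw [ht, div_lt_iff₀ hden, kappa₂_eq]
    nlinarith
  obtain ⟨r, hr, htail⟩ := exists_tail_le_mul_exp hsymm hconv ht0 ht1 hJ
  have hc : 0 < isoFunction μ t / t := div_pos hJ ht0
  have hH := hardyInequality_cond hsymm hc.le htail
  set c := isoFunction μ t / t with hcdef
  have hval : n * kappa₂ / kappa₁ * isoFunction μ t = c * m / (2 * kappa₁) := by
    rw [hmt, hcdef]
    field_simp
  rw [hval, boundaryMeasure]
  refine le_liminf_of_le (by isBoundedDefault) ?_
  -- The bound is linear in `h` for all small `h`, which makes the profile term `1 / 4` negligible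
  -- against `1 / h`.
  filter_upwards [Ioo_mem_nhdsGT (show (0 : ℝ) < 4 / 25 / c by positivity)] with h hh
  rw [ENNReal.le_div_iff_mul_le (Or.inl (by simpa using hh.1)) (Or.inl ENNReal.ofReal_ne_top),
    ← ENNReal.ofReal_mul (by positivity), ← ofReal_measureReal]
  refine ENNReal.ofReal_le_ofReal ?_
  exact mul_le_real_enlargement measurableSet_Icc hc ht0 hr hH hA hmpos (min_le_left _ _)
    (min_le_right _ _) (by linarith) (by linarith) hh.1 ((le_div_iff₀ hc).1 hh.2.le)
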